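/- Let $(W,R)$ be a Coxeter system: $W = \langle R \mid (rs)^{m_{rs}} = 1 \text{ for } r,s \in R \text{ with } m_{rs} \neq \infty\rangle$, where $R$ is a (possibly infinite) set, $m_{rr}=1$ for all $r \in R$, and $m_{rs}=m_{sr}\in\{2,3,\dots\}\cup\{\infty\}$ for $r\neq s$. Let $\Gamma$ be its Coxeter graph: the labelled graph with vertex set $R$ in which distinct $r,s$ are joined by an edge labelled $m_{rs}$ whenever $m_{rs}\ge 3$ (including $m_{rs}=\infty$). A reduced expression for $w \in W$ is a word in $R$ of minimal length among the words representing $w$. Then $W$ has only finitely many elements with a unique reduced expression if and only if $\Gamma$ is finite and each connected component of $\Gamma$ is a tree, has no infinite bonds (edges labelled $\infty$), and has at most one edge whose label is greater than three. -/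

import Mathlib

namespace CoxeterMatrix

variable {B : Type*} (M : CoxeterMatrix B)

/-- The value `m_{rs} ∈ {1, 2, 3, …} ∪ {∞}` of a Coxeter matrix (Mathlib's `CoxeterMatrix` encodes
the value `∞` as the natural number `0`). -/
def label (i j : B) : ℕ∞ := if M i j = 0 then ⊤ else (M i j : ℕ∞)

theorem label_symm (i j : B) : M.label i j = M.label j i := by
  unfold label
  rw [M.symmetric i j]

/-- The label `m_{rs}`, as a function of the unordered pair `{r, s}`. -/
def edgeLabel : Sym2 B → ℕ∞ := Sym2.lift ⟨M.label, M.label_symm⟩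

/-- The Coxeter graph: distinct `r`, `s` are joined by an edge whenever `m_{rs} ≥ 3`
(`m_{rs} = ∞` included). -/
def coxeterGraph : SimpleGraph B where
  Adj i j := i ≠ j ∧ 3 ≤ M.label i j
  symm := ⟨fun i j h => ⟨h.1.symm, M.label_symm i j ▸ h.2⟩⟩
  loopless := ⟨fun _ h => h.1 rfl⟩

/-- The edges of the Coxeter graph that lie in the connected component `C`. -/
def componentEdges (C : M.coxeterGraph.ConnectedComponent) : Set (Sym2 B) :=
  {e | e ∈ M.coxeterGraph.edgeSet ∧ ∀ i ∈ e, i ∈ C.supp}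

end CoxeterMatrix

namespace CoxeterSystem

variable {B : Type*} {M : CoxeterMatrix B} {W : Type*} [Group W] (cs : CoxeterSystem M W)

/-- `w` has exactly one reduced expression, that is, exactly one word in the distinguished
generators represents `w` and has minimal length among the words representing `w`. -/
def HasUniqueReducedExpression (w : W) : Prop :=
  ∃! ω : List B, cs.IsReduced ω ∧ cs.wordProd ω = w

end CoxeterSystem

/-!
Call a word in the generators *rigid* if it has no factor `i i` and no factor `i j i ⋯` that is one
side of a braid relation (alternating, of length `m_{ij} < ∞`). The elements with a unique reduced
expression are exactly the products of rigid words, and distinct rigid words have distinct products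
(`CoxeterSystem.hasUniqueReducedExpression_iff`,
`CoxeterSystem.finite_hasUniqueReducedExpression_iff`). So the question is when there are only
finitely many rigid words, which depends on the Coxeter graph alone.

A unique reduced expression is rigid because a braid move would produce another one. For the
converse, `CoxeterSystem.IsRigid.isReduced_and_unique` argues by induction on the length. The only
serious case is an element with two left descents `i ≠ j`: it then has a reduced expression that
begins with the full braid word in `i` and `j`
(`CoxeterSystem.exists_isReduced_braidWord_append`), and by induction that expression is the given
word, which is therefore not rigid. This takes two classical facts about Coxeter groups: the
exchange condition (`CoxeterSystem.exists_eraseIdx_of_isLeftDescent`), which follows from the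
well-definedness of the parity of the number of times a reflection occurs in the inversion sequence
of a word, and the fact that `s_i s_j` has order exactly `m_{ij}`
(`CoxeterSystem.orderOf_simple_mul_simple`), which is read off the geometric representation.

Rigid words are walks in the Coxeter graph which turn back only at edges with label greater than
three, and do not go back and forth along an edge too often. A cycle, an edge labelled `∞`, or two
edges with label greater than three in one component each give an infinite walk all of whose
initial segments are rigid: run around the cycle, alternate along the edge, or bounce between the
two edges. Conversely, in a finite forest a walk without turns has distinct vertices, so every long
enough stretch of a rigid word contains a turn; as all turns take place at one edge of a tree, they
are consecutive, and a very long rigid word would contain a braid word on that edge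
(`CoxeterSystem.IsRigid.length_le`).
-/

namespace CoxeterSystem

variable {B : Type*} {M : CoxeterMatrix B} {W : Type*} [Group W] (cs : CoxeterSystem M W)

/-! ### The exchange condition -/

open Classical in
/-- The map `(t, ε) ↦ (sᵢ t sᵢ, ε + [t = sᵢ])` of `W × ZMod 2`. These maps satisfy the Coxeter
relations, and the second coordinate of the resulting action records the parity of the number of
occurrences of `t` in an inversion sequence. The first coordinate runs over all of `W`, since
restricting it to the reflections is not needed. -/
noncomputable def reflectionFlip (i : B) : Function.End (W × ZMod 2) := fun p =>
  (cs.simple i * p.1 * cs.simple i, p.2 + if p.1 = cs.simple i then 1 else 0)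

open Classical in
theorem prod_reverse_map_reflectionFlip (ω : List B) (p : W × ZMod 2) :
    (ω.reverse.map cs.reflectionFlip).prod p =
      ((cs.wordProd ω)⁻¹ * p.1 * cs.wordProd ω, p.2 + ((cs.leftInvSeq ω).count p.1 : ℕ)) := by
  induction ω generalizing p with
  | nil => simp only [wordProd_nil, inv_one, one_mul, mul_one, leftInvSeq_nil, List.count_nil,
      Nat.cast_zero, add_zero]; rfl
  | cons i ω ih =>
    rw [List.reverse_cons, List.map_append, List.prod_append, List.map_singleton,
      List.prod_singleton]
    change (ω.reverse.map cs.reflectionFlip).prod (cs.reflectionFlip i p) = _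
    rw [ih]
    have hcount : (List.map (MulAut.conj (cs.simple i)) (cs.leftInvSeq ω)).count p.1 =
        (cs.leftInvSeq ω).count (cs.simple i * p.1 * cs.simple i) := by
      rw [← List.count_map_of_injective _ _ (MulAut.conj (cs.simple i)).injective
        (cs.simple i * p.1 * cs.simple i)]
      simp [mul_assoc]
    simp only [reflectionFlip, leftInvSeq, wordProd_cons, mul_inv_rev, inv_simple, mul_assoc,
      List.count_cons, hcount, Prod.mk.injEq, true_and, beq_iff_eq]
    by_cases h : p.1 = cs.simple i
    · simp [h]; ring
    · simp [h, Ne.symm h]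

/-- The left inversion sequence of the relator `(sᵢ sⱼ) ^ m` runs twice through the same list, so
that every element occurs in it an even number of times. -/
theorem leftInvSeq_alternatingWord_two_mul (i j : B) :
    cs.leftInvSeq (alternatingWord i j (2 * M i j)) =
      (cs.leftInvSeq (alternatingWord i j (2 * M i j))).take (M i j) ++
      (cs.leftInvSeq (alternatingWord i j (2 * M i j))).take (M i j) := by
  apply List.ext_getElem
  · simp; omega
  · intro k h₁ h₂
    simp only [length_leftInvSeq, length_alternatingWord] at h₁
    rw [List.getElem_append]
    split_ifs with h
    · simp
    · simp only [List.length_take, length_leftInvSeq, length_alternatingWord, not_lt] at h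
      have h' : min (M i j) (2 * M i j) = M i j := by omega
      simp only [List.getElem_take, List.length_take, length_leftInvSeq, length_alternatingWord, h']
      rw [cs.getElem_leftInvSeq_alternatingWord i j _ _ h₁,
        cs.getElem_leftInvSeq_alternatingWord i j _ _ (by omega)]
      obtain ⟨l, rfl⟩ : ∃ l, k = M i j + l := ⟨k - M i j, by omega⟩
      have e₁ : (2 * (M i j + l) + 1) / 2 = M i j + l := by omega
      have e₂ : (2 * (M i j + l - M i j) + 1) / 2 = l := by omega
      rw [prod_alternatingWord_eq_mul_pow, prod_alternatingWord_eq_mul_pow, e₁, e₂, pow_add]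
      simp

theorem isLiftable_reflectionFlip : M.IsLiftable cs.reflectionFlip := by
  classical
  intro i j
  have h : ∀ n, (cs.reflectionFlip i * cs.reflectionFlip j) ^ n =
      ((alternatingWord j i (2 * n)).reverse.map cs.reflectionFlip).prod := by
    intro n
    induction n with
    | zero => simp [alternatingWord]
    | succ n ih =>
      rw [pow_succ', ih, Nat.mul_succ, alternatingWord_succ, alternatingWord_succ]
      simp [mul_assoc]
  rw [h]
  funext p
  rw [prod_reverse_map_reflectionFlip, M.symmetric i j,
    leftInvSeq_alternatingWord_two_mul, List.count_append, prod_alternatingWord_eq_mul_pow]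
  have : (2 : ZMod 2) = 0 := rfl
  simp only [← two_mul, Nat.cast_mul, Nat.cast_ofNat, this, zero_mul, add_zero, even_two,
    Even.mul_right, if_true, one_mul, Nat.mul_div_cancel_left _ two_pos, simple_mul_simple_pow,
    inv_one, mul_one]
  rfl

open Classical in
/-- The parity of the number of occurrences of `t` in the left inversion sequence of a word depends
only on the product of the word. -/
theorem count_leftInvSeq_eq {ω ω' : List B} (h : cs.wordProd ω = cs.wordProd ω') (t : W) :
    ((cs.leftInvSeq ω).count t : ZMod 2) = ((cs.leftInvSeq ω').count t : ℕ) := by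
  have key : ∀ ω : List B, (ω.reverse.map cs.reflectionFlip).prod =
      cs.lift ⟨_, cs.isLiftable_reflectionFlip⟩ (cs.wordProd ω)⁻¹ := by
    intro ω
    rw [← wordProd_reverse, wordProd, map_list_prod, List.map_map]
    congr 2
    funext i
    exact (cs.lift_apply_simple _ i).symm
  have h' := (key ω).trans ((congrArg _ (congrArg _ h)).trans (key ω').symm)
  have h'' := congrArg Prod.snd (congrFun h' (t, 0))
  simpa only [prod_reverse_map_reflectionFlip, zero_add] using h''

/-- The exchange condition: if `i` is a left descent of the product of a word (reduced or not), then
multiplying by `sᵢ` on the left amounts to deleting a letter of the word. -/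
theorem exists_eraseIdx_of_isLeftDescent {ω : List B} {i : B}
    (h : cs.IsLeftDescent (cs.wordProd ω) i) :
    ∃ j < ω.length, cs.wordProd (ω.eraseIdx j) = cs.simple i * cs.wordProd ω := by
  classical
  obtain ⟨τ, hτ, hτω⟩ := cs.exists_isReduced (cs.simple i * cs.wordProd ω)
  have hprod : cs.wordProd (i :: τ) = cs.wordProd ω := by
    rw [wordProd_cons, ← hτω, simple_mul_simple_cancel_left]
  have hred : cs.IsReduced (i :: τ) := by
    have := cs.isLeftDescent_iff.mp h
    rw [IsReduced, hprod, ← this, hτω, hτ.eq, List.length_cons]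
  -- `sᵢ` occurs exactly once in the inversion sequence of the reduced word `i :: τ`, hence an odd
  -- number of times in that of `ω`
  have hcount := cs.count_leftInvSeq_eq hprod (cs.simple i)
  rw [List.count_eq_one_of_mem hred.nodup_leftInvSeq (by simp [leftInvSeq])] at hcount
  have hmem : cs.simple i ∈ cs.leftInvSeq ω := by
    by_contra hn
    rw [List.count_eq_zero_of_not_mem hn] at hcount
    simp at hcount
  obtain ⟨j, hj, hji⟩ := List.mem_iff_getElem.mp hmem
  refine ⟨j, by simpa using hj, ?_⟩
  rw [← getD_leftInvSeq_mul_wordProd, List.getD_eq_getElem _ _ hj, hji]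

end CoxeterSystem

/-! ### The order of a product of two generators -/

namespace CoxeterMatrix

variable {B : Type*} (M : CoxeterMatrix B)

open Polynomial.Chebyshev Module

/-- The linear form `2 ⟨αᵢ, ·⟩` on the space with basis the simple roots `αⱼ`, where
`⟨αᵢ, αⱼ⟩ = - cos (π / m_{ij})`. For `m_{ij} = ∞`, encoded as `0`, division by zero yields
`cos 0 = 1`, which is the customary value `⟨αᵢ, αⱼ⟩ = -1`. -/
noncomputable def coroot (i : B) : Dual ℝ (B →₀ ℝ) :=
  Finsupp.lsum ℝ fun j => (-2 * Real.cos (Real.pi / M i j)) • LinearMap.id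

theorem coroot_single (i j : B) :
    M.coroot i (Finsupp.single j 1) = -2 * Real.cos (Real.pi / M i j) := by
  simp [coroot]

theorem coroot_single_self (i : B) : M.coroot i (Finsupp.single i 1) = 2 := by
  simp [coroot_single]

/-- The action of the `i`-th generator in the geometric representation. -/
noncomputable def geometricReflection (i : B) : (B →₀ ℝ) ≃ₗ[ℝ] (B →₀ ℝ) :=
  reflection (M.coroot_single_self i)

theorem coroot_mul_coroot (i j : B) :
    M.coroot i (Finsupp.single j 1) * M.coroot j (Finsupp.single i 1) - 2 =
      2 * Real.cos (2 * (Real.pi / M i j)) := by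
  rw [coroot_single, coroot_single, M.symmetric j i, Real.cos_two_mul]
  ring

theorem sin_two_pi_div_ne_zero {m : ℕ} (hm : 3 ≤ m) : Real.sin (2 * (Real.pi / m)) ≠ 0 := by
  have hm' : (3 : ℝ) ≤ m := by exact_mod_cast hm
  apply (Real.sin_pos_of_pos_of_lt_pi (by have := Real.pi_pos; positivity) _).ne'
  rw [← mul_div_assoc, div_lt_iff₀ (by linarith)]
  nlinarith [Real.pi_pos]

theorem isLiftable_geometricReflection : M.IsLiftable M.geometricReflection := by
  intro i j
  rcases eq_or_ne (M i j) 0 with h0 | h0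
  · simp [h0]
  rcases eq_or_ne i j with rfl | hij
  · ext1 z
    simp [geometricReflection, involutive_reflection _ _]
  have h1 := M.off_diagonal i j hij
  apply LinearEquiv.ext
  intro z
  rw [geometricReflection, geometricReflection, reflection_mul_reflection_pow_apply _ _ _ _
    (2 * Real.cos (2 * (Real.pi / M i j))) (by rw [coroot_mul_coroot])]
  rcases eq_or_ne (M i j) 2 with h2 | h2
  · rw [coroot_single, coroot_single, M.symmetric j i, h2]
    have : 2 * (Real.pi / ((2 : ℕ) : ℝ)) = Real.pi := by push_cast; ring
    rw [this, Real.cos_pi]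
    norm_num
    module
  · -- with `t = 2 cos θ` and `θ = 2π / m`, one has `S_k(t) = sin ((k + 1) θ) / sin θ`; both
    -- coefficients in the formula for the `m`-th power vanish
    have hs := sin_two_pi_div_ne_zero (m := M i j) (by omega)
    have hm : (M i j : ℝ) ≠ 0 := by exact_mod_cast h0
    set θ := 2 * (Real.pi / M i j) with hθ
    have hmθ : M i j * θ = 2 * Real.pi := by rw [hθ]; field_simp
    generalize M i j = m at *
    have hS := fun n => Polynomial.Chebyshev.S_two_mul_real_cos θ n
    rcases Nat.even_or_odd' m with ⟨k, rfl | rfl⟩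
    · have a1 : (((2 * k : ℕ) : ℤ) - 2) / 2 = (k : ℤ) - 1 := by omega
      have a2 : (((2 * k : ℕ) : ℤ) - 1) / 2 = (k : ℤ) - 1 := by omega
      have hz : (S ℝ ((k : ℤ) - 1)).eval (2 * Real.cos θ) = 0 := by
        apply (mul_eq_zero.mp _).resolve_right hs
        rw [hS]
        push_cast at hmθ ⊢
        rw [sub_add_cancel, show (k : ℝ) * θ = Real.pi by linarith, Real.sin_pi]
      rw [a1, a2, hz]
      simp
    · have a1 : (((2 * k + 1 : ℕ) : ℤ) - 2) / 2 = (k : ℤ) - 1 := by omega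
      have a2 : (((2 * k + 1 : ℕ) : ℤ) - 1) / 2 = (k : ℤ) := by omega
      have a3 : (((2 * k + 1 : ℕ) : ℤ) - 3) / 2 = (k : ℤ) - 1 := by omega
      have a4 : (((2 * k + 1 : ℕ) : ℤ)) / 2 = (k : ℤ) := by omega
      have hz : (S ℝ k).eval (2 * Real.cos θ) + (S ℝ ((k : ℤ) - 1)).eval (2 * Real.cos θ) = 0 := by
        apply (mul_eq_zero.mp _).resolve_right hs
        rw [add_mul, hS, hS]
        push_cast at hmθ ⊢
        rw [sub_add_cancel, show ((k : ℝ) + 1) * θ = 2 * Real.pi - k * θ by linarith,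
          Real.sin_two_pi_sub, neg_add_cancel]
      rw [a1, a2, a3, a4, hz]
      simp

theorem dvd_of_geometricReflection_mul_pow_eq_one {i j : B} (hij : i ≠ j) {n : ℕ}
    (h : (M.geometricReflection i * M.geometricReflection j) ^ n = 1) : M i j ∣ n := by
  have hx := LinearEquiv.congr_fun h (Finsupp.single i 1)
  rw [geometricReflection, geometricReflection, reflection_mul_reflection_pow_apply_self _ _ _
    (2 * Real.cos (2 * (Real.pi / M i j))) (by rw [coroot_mul_coroot])] at hx
  have hxi := DFunLike.congr_fun hx i
  have hxj := DFunLike.congr_fun hx j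
  simp [hij, hij.symm, coroot_single, M.symmetric j i] at hxi hxj
  have h1 := M.off_diagonal i j hij
  -- the coefficients of `αᵢ` and `αⱼ` in `(rᵢ rⱼ) ^ n αᵢ = αᵢ` force `n` to be a multiple of `m`;
  -- the cases `t = 2` and `t = -2`, where `sin θ = 0`, are treated apart
  rcases eq_or_ne (M i j) 0 with h0 | h0
  · rw [h0] at hxj ⊢
    simpa [S_eval_two] using hxj
  rcases eq_or_ne (M i j) 2 with h2 | h2
  · rw [h2] at hxi ⊢
    have : 2 * (Real.pi / ((2 : ℕ) : ℝ)) = Real.pi := by push_cast; ring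
    rw [this, Real.cos_pi] at hxi
    by_contra hn
    have hodd : Odd (n : ℤ) := by
      rw [← even_iff_two_dvd, Nat.not_even_iff_odd] at hn
      exact_mod_cast hn
    have heven : Even ((n : ℤ) - 1) := by
      obtain ⟨k, hk⟩ := hodd
      exact ⟨k, by omega⟩
    rw [show (2 * -1 : ℝ) = -2 by norm_num, S_eval_neg_two, S_eval_neg_two,
      Int.negOnePow_odd _ hodd, Int.negOnePow_even _ heven] at hxi
    push_cast at hxi
    linarith
  · have hs := sin_two_pi_div_ne_zero (m := M i j) (by omega)
    have hm : (M i j : ℝ) ≠ 0 := by exact_mod_cast h0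
    have hcos : Real.cos (Real.pi / M i j) ≠ 0 := by
      intro hc
      rw [Real.sin_two_mul, hc, mul_zero] at hs
      exact hs rfl
    have hxj := hxj.resolve_right hcos
    rw [hxj, add_zero] at hxi
    set θ := 2 * (Real.pi / M i j) with hθ
    have h2 := Polynomial.Chebyshev.S_two_mul_real_cos θ n
    have h3 := Polynomial.Chebyshev.S_two_mul_real_cos θ (n - 1)
    rw [hxi, one_mul] at h2
    rw [hxj, zero_mul] at h3
    push_cast at h2 h3
    rw [sub_add_cancel] at h3
    rw [add_mul, one_mul, Real.sin_add, ← h3, zero_mul, zero_add] at h2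
    have hcosn : Real.cos (n * θ) = 1 := by
      apply mul_right_cancel₀ hs
      rw [one_mul, ← h2]
    obtain ⟨k, hk⟩ := (Real.cos_eq_one_iff _).mp hcosn
    have hkn : (k : ℝ) * M i j = n := by
      have := Real.pi_ne_zero
      rw [hθ] at hk
      field_simp at hk
      linarith
    have : (M i j : ℤ) ∣ n := ⟨k, by rw [mul_comm]; exact_mod_cast hkn.symm⟩
    exact_mod_cast this

end CoxeterMatrix

namespace CoxeterSystem

variable {B : Type*} {M : CoxeterMatrix B} {W : Type*} [Group W] (cs : CoxeterSystem M W)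

/-- The product of two generators has the order prescribed by the Coxeter matrix; infinite order is
encoded as `0` on both sides. -/
theorem orderOf_simple_mul_simple (i j : B) : orderOf (cs.simple i * cs.simple j) = M i j := by
  rcases eq_or_ne i j with rfl | hij
  · simp
  apply Nat.dvd_antisymm (orderOf_dvd_of_pow_eq_one (cs.simple_mul_simple_pow i j))
  apply M.dvd_of_geometricReflection_mul_pow_eq_one hij
  have h := congrArg (cs.lift ⟨_, M.isLiftable_geometricReflection⟩)
    (pow_orderOf_eq_one (cs.simple i * cs.simple j))
  rwa [map_one, map_pow, map_mul, lift_apply_simple, lift_apply_simple] at h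

end CoxeterSystem

/-! ### Words admitting no braid move -/

namespace CoxeterSystem

variable {B : Type*} {M : CoxeterMatrix B} {W : Type*} [Group W] (cs : CoxeterSystem M W)

variable (M) in
/-- A word is rigid if it has no factor `i i` and no factor that is one side of a braid relation. An
entry `M i j = 0` encodes `m_{ij} = ∞` and gives no condition; an entry `M i j = 2` forbids the
factor `i j`. -/
def IsRigid (ω : List B) : Prop :=
  (∀ i, ¬ [i, i] <:+: ω) ∧ ∀ i j, i ≠ j → M i j ≠ 0 → ¬ braidWord M i j <:+: ω

theorem IsRigid.of_isInfix {ω ω' : List B} (h : IsRigid M ω) (h' : ω' <:+: ω) : IsRigid M ω' :=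
  ⟨fun i hi => h.1 i (hi.trans h'), fun i j hij hM hb => h.2 i j hij hM (hb.trans h')⟩

theorem alternatingWord_ne_alternatingWord {i j : B} (hij : i ≠ j) {m : ℕ} (hm : m ≠ 0) :
    alternatingWord i j m ≠ alternatingWord j i m := by
  obtain ⟨m, rfl⟩ := Nat.exists_eq_succ_of_ne_zero hm
  intro h
  rw [alternatingWord_succ', alternatingWord_succ', List.cons.injEq] at h
  split_ifs at h
  exacts [hij h.1.symm, hij h.1]

/-- A unique reduced expression is rigid, since a braid move leads to a different reduced expression
of the same element. -/
theorem isRigid_of_isReduced {ω : List B} (hω : cs.IsReduced ω)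
    (huniq : ∀ τ, cs.IsReduced τ → cs.wordProd τ = cs.wordProd ω → τ = ω) : IsRigid M ω := by
  refine ⟨?_, ?_⟩
  · rintro i ⟨σ, τ, rfl⟩
    have h : cs.wordProd (σ ++ [i, i] ++ τ) = cs.wordProd (σ ++ τ) := by
      simp [wordProd_append, wordProd_cons]
    have h' := cs.length_wordProd_le (σ ++ τ)
    rw [← h, hω.eq] at h'
    simp at h'
  · rintro i j hij hM ⟨σ, τ, rfl⟩
    have h : cs.wordProd (σ ++ braidWord M j i ++ τ) = cs.wordProd (σ ++ braidWord M i j ++ τ) := by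
      simp only [wordProd_append, wordProd_braidWord_eq cs i j]
    have heq := huniq _ (by rw [IsReduced, h, hω.eq]; simp [M.symmetric j i]) h
    rw [List.append_left_inj, List.append_right_inj, braidWord, braidWord, M.symmetric j i] at heq
    exact alternatingWord_ne_alternatingWord hij hM heq.symm

/-- Deleting the letter at index `k` from an alternating word, compared with extending the word by
one letter on the left: the two products differ by the `(k + 1)`-st power of the product of the two
generators. -/
theorem wordProd_alternatingWord_succ_eq_pow_mul (i j : B) {n k : ℕ} (hk : k < n) :
    cs.wordProd (alternatingWord i j (n + 1)) =
      (cs.simple (if Even n then j else i) * cs.simple (if Even n then i else j)) ^ (k + 1) *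
        cs.wordProd ((alternatingWord i j n).eraseIdx k) := by
  induction k generalizing n with
  | zero =>
    obtain ⟨n, rfl⟩ := Nat.exists_eq_succ_of_ne_zero hk.ne'
    rw [alternatingWord_succ', alternatingWord_succ']
    by_cases h : Even n <;> simp [h, Nat.even_add_one, wordProd_cons, mul_assoc]
  | succ k ih =>
    obtain ⟨n, rfl⟩ := Nat.exists_eq_succ_of_ne_zero (Nat.zero_lt_of_lt hk).ne'
    rw [alternatingWord_succ', wordProd_cons, ih (by omega : k < n), alternatingWord_succ' i j n,
      List.eraseIdx_cons_succ, wordProd_cons]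
    by_cases h : Even n <;>
      simp [h, Nat.even_add_one, ← mul_assoc, ← mul_pow_mul, pow_succ _ (k + 1)]

/-- The product of `sᵢ` and `sⱼ` having order `M i j`, an alternating word can be extended by one
letter and shortened by one letter with the same effect only if it is at least as long as the braid
word. -/
theorem le_of_wordProd_eraseIdx_alternatingWord {i j : B} {n k : ℕ} (hk : k < n)
    (h : cs.wordProd ((alternatingWord i j n).eraseIdx k) =
      cs.wordProd (alternatingWord i j (n + 1))) : M i j ≠ 0 ∧ M i j ≤ n := by
  rw [wordProd_alternatingWord_succ_eq_pow_mul cs i j hk, right_eq_mul] at h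
  have hdvd : M i j ∣ k + 1 := by
    have := orderOf_dvd_of_pow_eq_one h
    rw [orderOf_simple_mul_simple] at this
    split_ifs at this
    exacts [M.symmetric i j ▸ this, this]
  exact ⟨fun h0 => by simp [h0] at hdvd, (Nat.le_of_dvd k.succ_pos hdvd).trans hk⟩

/-- An element with a reduced expression that begins with an alternating word shorter than the braid
word, and with the other letter as a left descent, has a reduced expression that begins with the
alternating word longer by one: the exchange condition must delete a letter outside of the
alternating word. -/
theorem exists_isReduced_alternatingWord_succ {i j : B} {n : ℕ} (hn : M i j = 0 ∨ n < M i j)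
    {τ : List B} (hτ : cs.IsReduced (alternatingWord i j n ++ τ))
    (hd : cs.IsLeftDescent (cs.wordProd (alternatingWord i j n ++ τ))
      (if Even n then j else i)) :
    ∃ σ, cs.IsReduced (alternatingWord i j (n + 1) ++ σ) ∧
      cs.wordProd (alternatingWord i j (n + 1) ++ σ) =
        cs.wordProd (alternatingWord i j n ++ τ) := by
  obtain ⟨k, hk, hkprod⟩ := cs.exists_eraseIdx_of_isLeftDescent hd
  rcases lt_or_ge k n with hkn | hkn
  · exfalso
    rw [List.eraseIdx_append_of_lt_length (by simpa using hkn), wordProd_append, wordProd_append,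
      ← mul_assoc, mul_left_inj, ← wordProd_cons, ← alternatingWord_succ'] at hkprod
    have := cs.le_of_wordProd_eraseIdx_alternatingWord hkn hkprod
    omega
  · rw [List.eraseIdx_append_of_length_le (by simpa using hkn)] at hkprod
    have hprod : cs.wordProd (alternatingWord i j (n + 1) ++ τ.eraseIdx (k - n)) =
        cs.wordProd (alternatingWord i j n ++ τ) := by
      rw [alternatingWord_succ', List.cons_append, wordProd_cons]
      simpa using congrArg (cs.simple (if Even n then j else i) * ·) hkprod
    refine ⟨τ.eraseIdx (k - n), ?_, hprod⟩
    rw [IsReduced, hprod, hτ.eq]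
    simp only [List.length_append, length_alternatingWord] at hk ⊢
    rw [List.length_eraseIdx_of_lt (by omega)]
    omega

/-- If `i` and `j` are left descents of `w`, then `M i j` is finite and `w` has a reduced expression
that begins with the braid word. -/
theorem exists_isReduced_braidWord_append {w : W} {i j : B}
    (hi : cs.IsLeftDescent w i) (hj : cs.IsLeftDescent w j) :
    M i j ≠ 0 ∧ ∃ τ : List B, cs.IsReduced (braidWord M i j ++ τ) ∧
      cs.wordProd (braidWord M i j ++ τ) = w := by
  have key : ∀ n, M i j = 0 ∨ n ≤ M i j → ∃ τ, cs.IsReduced (alternatingWord i j n ++ τ) ∧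
      cs.wordProd (alternatingWord i j n ++ τ) = w := by
    intro n
    induction n with
    | zero =>
      intro _
      obtain ⟨τ, hτ, hτ'⟩ := cs.exists_isReduced w
      exact ⟨τ, hτ, hτ'.symm⟩
    | succ n ih =>
      intro hn
      obtain ⟨τ, hτ, rfl⟩ := ih (by omega)
      refine cs.exists_isReduced_alternatingWord_succ (by omega) hτ ?_
      split_ifs
      exacts [hj, hi]
  have hM : M i j ≠ 0 := by
    intro h0
    obtain ⟨τ, hτ, hτ'⟩ := key (cs.length w + 1) (Or.inl h0)
    rw [IsReduced, hτ', List.length_append, length_alternatingWord] at hτ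
    omega
  exact ⟨hM, key _ (Or.inr le_rfl)⟩

/-- A rigid word is reduced, and it is the only reduced expression of its product. -/
theorem IsRigid.isReduced_and_unique {ω : List B} (h : IsRigid M ω) :
    cs.IsReduced ω ∧ ∀ τ, cs.IsReduced τ → cs.wordProd τ = cs.wordProd ω → τ = ω := by
  induction ω with
  | nil =>
    refine ⟨by simp [IsReduced], fun τ hτ h => ?_⟩
    rw [IsReduced, h, wordProd_nil, length_one] at hτ
    exact List.eq_nil_of_length_eq_zero hτ.symm
  | cons i ω ih =>
    obtain ⟨hred, huniq⟩ := ih (h.of_isInfix (List.suffix_cons i ω).isInfix)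
    -- otherwise `ω`, the unique reduced expression of its product, would begin with `i`
    have hnd : ¬ cs.IsLeftDescent (cs.wordProd ω) i := by
      intro hd
      obtain ⟨τ, hτ, hτ'⟩ := cs.exists_isReduced (cs.simple i * cs.wordProd ω)
      have hprod : cs.wordProd (i :: τ) = cs.wordProd ω := by
        rw [wordProd_cons, ← hτ', simple_mul_simple_cancel_left]
      have hred' : cs.IsReduced (i :: τ) := by
        rw [IsReduced, hprod, ← cs.isLeftDescent_iff.mp hd, hτ', hτ.eq, List.length_cons]
      obtain rfl := huniq _ hred' hprod
      exact h.1 i (List.prefix_append [i, i] τ).isInfix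
    have hlen := cs.not_isLeftDescent_iff.mp hnd
    have hred' : cs.IsReduced (i :: ω) := by
      rw [IsReduced, wordProd_cons, hlen, hred.eq, List.length_cons]
    -- cancel a common first letter
    have hcons : ∀ τ, cs.IsReduced (i :: τ) → cs.wordProd (i :: τ) = cs.wordProd (i :: ω) →
        i :: τ = i :: ω := by
      intro τ hτ heq
      rw [wordProd_cons, wordProd_cons, mul_right_inj] at heq
      rw [huniq τ (by simpa using hτ.drop 1) heq]
    refine ⟨hred', fun τ hτ heq => ?_⟩
    match τ with
    | [] =>
      rw [IsReduced, heq, hred'.eq] at hτ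
      simp at hτ
    | j :: τ =>
      rcases eq_or_ne j i with rfl | hji
      · exact hcons τ hτ heq
      exfalso
      have hdi : cs.IsLeftDescent (cs.wordProd (i :: ω)) i := by
        rw [IsLeftDescent, hred'.eq, wordProd_cons, simple_mul_simple_cancel_left, hred.eq]
        simp
      have hdj : cs.IsLeftDescent (cs.wordProd (i :: ω)) j := by
        rw [IsLeftDescent, ← heq, hτ.eq, wordProd_cons, simple_mul_simple_cancel_left]
        exact (cs.length_wordProd_le τ).trans_lt (by simp)
      -- a reduced expression that begins with a braid word starting with `i` must be `i :: ω`
      have key : ∀ a b, M a b ≠ 0 → a ≠ b → ∀ σ, cs.IsReduced (braidWord M a b ++ σ) →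
          cs.wordProd (braidWord M a b ++ σ) = cs.wordProd (i :: ω) →
          (braidWord M a b).head? = some i → False := by
        intro a b hM hab σ hσ hσ' hhead
        obtain ⟨ρ, hρ⟩ : ∃ ρ, braidWord M a b = i :: ρ := by
          cases hw : braidWord M a b with
          | nil => simp [hw] at hhead
          | cons x ρ => exact ⟨ρ, by simpa [hw] using hhead⟩
        have := hcons (ρ ++ σ) (by rwa [hρ] at hσ) (by rwa [hρ] at hσ')
        apply h.2 a b hab hM
        rw [← this, hρ]
        exact (List.prefix_append (i :: ρ) σ).isInfix
      obtain ⟨hM, σ, hσ, hσ'⟩ := cs.exists_isReduced_braidWord_append hdi hdj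
      obtain ⟨hM', σ', hτ, hτ'⟩ := cs.exists_isReduced_braidWord_append hdj hdi
      obtain ⟨m, hm⟩ := Nat.exists_eq_succ_of_ne_zero hM
      -- `braidWord M a b` ends with `b`, so the parity of `M i j` decides which of the two braid
      -- words starts with `i`
      by_cases hme : Even m
      · apply key j i hM' hji σ' hτ hτ'
        simp [braidWord, M.symmetric j i, hm, alternatingWord_succ', hme]
      · apply key i j hM hji.symm σ hσ hσ'
        simp [braidWord, hm, alternatingWord_succ', hme]

theorem hasUniqueReducedExpression_iff {w : W} :
    cs.HasUniqueReducedExpression w ↔ ∃ ω, IsRigid M ω ∧ cs.wordProd ω = w := by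
  constructor
  · rintro ⟨ω, ⟨hω, rfl⟩, huniq⟩
    exact ⟨ω, cs.isRigid_of_isReduced hω fun τ hτ h => huniq τ ⟨hτ, h⟩, rfl⟩
  · rintro ⟨ω, hω, rfl⟩
    obtain ⟨h1, h2⟩ := hω.isReduced_and_unique cs
    exact ⟨ω, ⟨h1, rfl⟩, fun τ hτ => h2 τ hτ.1 hτ.2⟩

theorem finite_hasUniqueReducedExpression_iff :
    {w : W | cs.HasUniqueReducedExpression w}.Finite ↔ {ω : List B | IsRigid M ω}.Finite := by
  have himage : {w : W | cs.HasUniqueReducedExpression w} = cs.wordProd '' {ω | IsRigid M ω} := by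
    ext w
    exact cs.hasUniqueReducedExpression_iff
  rw [himage]
  apply Set.finite_image_iff
  intro ω hω τ hτ heq
  exact (hτ.isReduced_and_unique cs).2 ω (hω.isReduced_and_unique cs).1 heq

end CoxeterSystem

/-! ### The Coxeter graph -/

namespace CoxeterMatrix

variable {B : Type*} (M : CoxeterMatrix B)

theorem coxeterGraph_adj_iff {i j : B} : M.coxeterGraph.Adj i j ↔ i ≠ j ∧ M i j ≠ 2 := by
  change i ≠ j ∧ 3 ≤ M.label i j ↔ _
  refine and_congr_right fun hij => ?_
  have h1 := M.off_diagonal i j hij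
  unfold label
  split_ifs with h
  · simp [h]
  · norm_cast
    omega

theorem label_eq_top_iff {i j : B} : M.label i j = ⊤ ↔ M i j = 0 := by
  unfold label
  split_ifs with h <;> simp [h]

theorem three_lt_label_iff {i j : B} (h : M.coxeterGraph.Adj i j) :
    3 < M.label i j ↔ M i j ≠ 3 := by
  obtain ⟨hij, h2⟩ := M.coxeterGraph_adj_iff.mp h
  have h1 := M.off_diagonal i j hij
  unfold label
  split_ifs with h
  · simpa [h] using ENat.natCast_lt_top 3
  · norm_cast
    omega

end CoxeterMatrix

namespace SimpleGraph

variable {V : Type*} {G : SimpleGraph V}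

theorem isAcyclic_of_forall_connectedComponent
    (h : ∀ C : G.ConnectedComponent, C.toSimpleGraph.IsAcyclic) : G.IsAcyclic := by
  classical
  intro v p hp
  have hsupp : ∀ x ∈ p.support, x ∈ (G.connectedComponentMk v).supp := by
    intro x hx
    exact ConnectedComponent.sound ((p.takeUntil x hx).reachable.symm)
  refine h (G.connectedComponentMk v) (p.induce _ hsupp)
    (Walk.IsCycle.of_map (f := (Embedding.induce _).toHom) ?_)
  rwa [Walk.map_induce]

theorem exists_walk_getVert_eq (n : ℕ) (q : ℕ → V) (h : ∀ k < n, G.Adj (q k) (q (k + 1))) :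
    ∃ p : G.Walk (q 0) (q n), p.length = n ∧ ∀ k ≤ n, p.getVert k = q k := by
  induction n generalizing q with
  | zero => exact ⟨Walk.nil, rfl, fun k hk => by simp [Nat.le_zero.mp hk]⟩
  | succ n ih =>
    obtain ⟨p, hp, hq⟩ := ih (fun k => q (k + 1)) fun k hk => h (k + 1) (by omega)
    refine ⟨Walk.cons (h 0 (by omega)) p, by simp [hp], fun k hk => ?_⟩
    cases k with
    | zero => simp
    | succ k => simpa using hq k (by omega)

theorem Walk.isChain_edges_of_getVert_ne {u v : V} (p : G.Walk u v)
    (h : ∀ k, k + 2 ≤ p.length → p.getVert k ≠ p.getVert (k + 2)) :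
    List.IsChain (· ≠ ·) p.edges := by
  induction p with
  | nil => simp
  | cons hadj p ih =>
    have hih := ih fun k hk => by simpa using h (k + 1) (by simpa using hk)
    cases p with
    | nil => simp
    | cons hadj' p =>
      rw [Walk.edges_cons, Walk.edges_cons, List.isChain_cons_cons]
      rw [Walk.edges_cons] at hih
      refine ⟨fun heq => ?_, hih⟩
      have := h 0 (by simp)
      simp at this
      rw [Sym2.eq_iff] at heq
      rcases heq with ⟨h1, h2⟩ | ⟨h1, h2⟩
      · exact hadj.ne h1
      · exact this h1

/-- In an acyclic graph, a sequence of successively adjacent vertices that never turns back has no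
repetition. -/
theorem IsAcyclic.injOn_of_ne (hG : G.IsAcyclic) {q : ℕ → V} {a b : ℕ}
    (hadj : ∀ k, a ≤ k → k < b → G.Adj (q k) (q (k + 1)))
    (hne : ∀ k, a ≤ k → k + 2 ≤ b → q k ≠ q (k + 2)) : Set.InjOn q (Set.Icc a b) := by
  intro x hx y hy hxy
  simp only [Set.mem_Icc] at hx hy
  obtain ⟨p, hp, hpq⟩ := exists_walk_getVert_eq (G := G) (b - a) (fun k => q (a + k))
    fun k hk => hadj (a + k) (by omega) (by omega)
  have hpath : p.IsPath := by
    rw [hG.isPath_iff_isChain]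
    apply p.isChain_edges_of_getVert_ne
    intro k hk
    rw [hpq k (by omega), hpq (k + 2) (by omega)]
    exact hne (a + k) (by omega) (by omega)
  have hxy' : p.getVert (x - a) = p.getVert (y - a) := by
    rw [hpq _ (by omega), hpq _ (by omega), Nat.add_sub_cancel' hx.1, Nat.add_sub_cancel' hy.1,
      hxy]
  have := hpath.getVert_injOn (by rw [Set.mem_ofPred_eq]; omega)
    (by rw [Set.mem_ofPred_eq]; omega) hxy'
  omega

end SimpleGraph

namespace CoxeterMatrix

variable {B : Type*} (M : CoxeterMatrix B)

/-- The condition on the components of the Coxeter graph, in terms of the Coxeter matrix. -/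
theorem forall_connectedComponent_iff :
    (∀ C : M.coxeterGraph.ConnectedComponent, C.toSimpleGraph.IsTree ∧
        (∀ e ∈ M.componentEdges C, M.edgeLabel e ≠ ⊤) ∧
        {e ∈ M.componentEdges C | 3 < M.edgeLabel e}.encard ≤ 1) ↔
      M.coxeterGraph.IsAcyclic ∧ (∀ i j, M i j ≠ 0) ∧
        ∀ i j k l, M.coxeterGraph.Adj i j → M.coxeterGraph.Adj k l →
          M.coxeterGraph.Reachable i k → M i j ≠ 3 → M k l ≠ 3 → s(i, j) = s(k, l) := by
  have hmem : ∀ {i j : B} (C), M.coxeterGraph.Adj i j → i ∈ C.supp →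
      s(i, j) ∈ M.componentEdges C := by
    intro i j C hij hi
    refine ⟨hij, fun x hx => ?_⟩
    rcases Sym2.mem_iff.mp hx with rfl | rfl
    · exact hi
    · exact (SimpleGraph.ConnectedComponent.mem_supp_congr_adj C hij).mp hi
  constructor
  · intro h
    refine ⟨SimpleGraph.isAcyclic_of_forall_connectedComponent fun C => (h C).1.isAcyclic,
      fun i j h0 => ?_, fun i j k l hij hkl hik h1 h2 => ?_⟩
    · have hij : i ≠ j := by
        rintro rfl
        simp at h0
      have hadj := M.coxeterGraph_adj_iff.mpr ⟨hij, by omega⟩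
      exact (h (M.coxeterGraph.connectedComponentMk i)).2.1 s(i, j) (hmem _ hadj rfl)
        (M.label_eq_top_iff.mpr h0)
    · exact Set.encard_le_one_iff.mp (h (M.coxeterGraph.connectedComponentMk i)).2.2 _ _
        ⟨hmem _ hij rfl, (M.three_lt_label_iff hij).mpr h1⟩
        ⟨hmem _ hkl (SimpleGraph.ConnectedComponent.sound hik.symm),
          (M.three_lt_label_iff hkl).mpr h2⟩
  · rintro ⟨hacyc, h0, hheavy⟩ C
    refine ⟨hacyc.isTree_connectedComponent C, ?_, ?_⟩
    · intro e _
      induction e with | _ i j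
      exact fun htop => h0 i j (M.label_eq_top_iff.mp htop)
    · rw [Set.encard_le_one_iff]
      rintro e f ⟨he, he'⟩ ⟨hf, hf'⟩
      induction e with | _ i j
      induction f with | _ k l
      refine hheavy i j k l he.1 hf.1 ?_ ((M.three_lt_label_iff he.1).mp he')
        ((M.three_lt_label_iff hf.1).mp hf')
      exact C.reachable_of_mem_supp (he.2 i (Sym2.mem_mk_left i j)) (hf.2 k (Sym2.mem_mk_left k l))

end CoxeterMatrix

/-! ### Rigid words as walks in the Coxeter graph -/

namespace CoxeterSystem

variable {B : Type*} {M : CoxeterMatrix B}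

theorem alternatingWord_isInfix {ω : List B} {i j : B} {m p : ℕ} (hlen : p + m ≤ ω.length)
    (h : ∀ t < m, ω[p + t]? = some (if Even (m + t) then i else j)) :
    alternatingWord i j m <:+: ω := by
  rw [List.infix_iff_getElem?]
  refine ⟨p, by simpa [add_comm] using hlen, fun t ht => ?_⟩
  rw [length_alternatingWord] at ht
  rw [getElem_alternatingWord i j m t ht, add_comm t p, h t ht]

/-- If a rigid word has enough letters after the position `p`, then it cannot alternate between the
letters at `p` and `p + 1` for as many letters as their label. -/
theorem IsRigid.exists_ne_add_two {ω : List B} (hω : IsRigid M ω) {q : ℕ → B}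
    (hq : ∀ k < ω.length, ω[k]? = some (q k)) {p : ℕ} (hne : q p ≠ q (p + 1))
    (h0 : M (q p) (q (p + 1)) ≠ 0) (hp : p + M (q p) (q (p + 1)) ≤ ω.length) :
    ∃ t, t + 2 < M (q p) (q (p + 1)) ∧ q (p + t) ≠ q (p + t + 2) := by
  by_contra! hcon
  set m := M (q p) (q (p + 1)) with hm
  have halt : ∀ t < m, q (p + t) = if Even t then q p else q (p + 1) := by
    intro t
    induction t using Nat.strong_induction_on with
    | _ t ih =>
      intro ht
      match t with
      | 0 => simp
      | 1 => simp
      | t + 2 =>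
        rw [← add_assoc, ← hcon t ht, ih t (by omega) (by omega)]
        simp [Nat.even_add]
  by_cases hme : Even m
  · refine hω.2 (q p) (q (p + 1)) hne h0 (alternatingWord_isInfix hp fun t ht => ?_)
    rw [hq _ (by omega), halt t ht]
    simp [Nat.even_add, ← hm, hme]
  · refine hω.2 (q (p + 1)) (q p) hne.symm (by rwa [M.symmetric]) ?_
    rw [braidWord, M.symmetric, ← hm]
    refine alternatingWord_isInfix hp fun t ht => ?_
    rw [hq _ (by omega), halt t ht]
    by_cases ht' : Even t <;> simp [Nat.even_add, hme, ht']

theorem IsRigid.adj {ω : List B} (hω : IsRigid M ω) {q : ℕ → B}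
    (hq : ∀ k < ω.length, ω[k]? = some (q k)) {k : ℕ} (hk : k + 1 < ω.length) :
    M.coxeterGraph.Adj (q k) (q (k + 1)) := by
  have hne : q k ≠ q (k + 1) := by
    intro heq
    apply hω.1 (q k)
    rw [List.infix_iff_getElem?]
    refine ⟨k, by simp; omega, fun t ht => ?_⟩
    have : t = 0 ∨ t = 1 := by simp at ht; omega
    rcases this with rfl | rfl
    · simpa using hq k (by omega)
    · rw [add_comm, hq _ hk, ← heq]
      rfl
  refine M.coxeterGraph_adj_iff.mpr ⟨hne, fun h2 => ?_⟩
  obtain ⟨t, ht, -⟩ := hω.exists_ne_add_two hq hne (by omega) (by omega)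
  omega

/-- A rigid word turns back only at edges with label greater than three. -/
theorem IsRigid.ne_three {ω : List B} (hω : IsRigid M ω) {q : ℕ → B}
    (hq : ∀ k < ω.length, ω[k]? = some (q k)) {k : ℕ} (hk : k + 2 < ω.length)
    (hturn : q k = q (k + 2)) : M (q k) (q (k + 1)) ≠ 3 := by
  intro h3
  obtain ⟨t, ht, ht'⟩ := hω.exists_ne_add_two hq
    (hω.adj hq (show k + 1 < ω.length by omega)).ne (by omega) (by omega)
  obtain rfl : t = 0 := by omega
  exact ht' hturn

/-- The initial segments of a walk in the Coxeter graph are rigid if the walk turns back only at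
edges with label greater than three, and does not turn back twice in succession except at edges
labelled `∞`. -/
theorem isRigid_map_range {q : ℕ → B} (hadj : ∀ k, M.coxeterGraph.Adj (q k) (q (k + 1)))
    (hturn : ∀ k, q k = q (k + 2) →
      M (q k) (q (k + 1)) ≠ 3 ∧ (q (k + 1) = q (k + 3) → M (q k) (q (k + 1)) = 0)) (n : ℕ) :
    IsRigid M ((List.range n).map q) := by
  constructor
  · intro i hi
    rw [List.infix_iff_getElem?] at hi
    obtain ⟨p, hp, h⟩ := hi
    simp only [List.length_cons, List.length_nil, List.length_map, List.length_range] at hp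
    have h0 := h 0 (by simp)
    have h1 := h 1 (by simp)
    simp [show p < n by omega, show 1 + p < n by omega] at h0 h1
    apply (hadj p).ne
    rw [h0, add_comm p 1, h1]
  · intro i j hij hM hinf
    rw [List.infix_iff_getElem?] at hinf
    obtain ⟨p, hp, h⟩ := hinf
    simp only [length_alternatingWord, List.length_map, List.length_range] at hp
    have hletter : ∀ t < M i j, q (p + t) = if Even (M i j + t) then i else j := by
      intro t ht
      have := h t (by simpa using ht)
      rw [getElem_alternatingWord i j _ t ht] at this
      simpa [show p + t < n by omega, add_comm t p] using this
    have hM1 := M.off_diagonal i j hij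
    have hlab : M (q p) (q (p + 1)) = M i j := by
      have h0 := hletter 0 (by omega)
      have h1 := hletter 1 (by omega)
      rw [add_zero] at h0
      rw [h0, h1]
      by_cases he : Even (M i j)
      · simp [he, Nat.even_add_one]
      · simp [he, Nat.even_add_one, M.symmetric j i]
    have h2 := (M.coxeterGraph_adj_iff.mp (hadj p)).2
    have hrep : ∀ t, t + 2 < M i j → q (p + t) = q (p + t + 2) := by
      intro t ht
      rw [hletter t (by omega), add_assoc, hletter (t + 2) ht]
      simp [Nat.even_add]
    obtain ⟨h3, h4⟩ := hturn p (by simpa using hrep 0 (by omega))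
    exact hM (hlab ▸ h4 (hrep 1 (by omega)))

/-! ### Infinite families of rigid words -/

theorem infinite_isRigid {q : ℕ → B} (h : ∀ n, IsRigid M ((List.range n).map q)) :
    {ω : List B | IsRigid M ω}.Infinite := by
  refine Set.infinite_of_injective_forall_mem (f := fun n => (List.range n).map q) ?_ h
  intro m n hmn
  simpa using congrArg List.length hmn

theorem infinite_isRigid_of_eq_zero {i j : B} (h : M i j = 0) :
    {ω : List B | IsRigid M ω}.Infinite := by
  have hij : i ≠ j := by
    rintro rfl
    simp at h
  have hs := M.symmetric j i
  refine infinite_isRigid (q := fun k => if Even k then i else j) (isRigid_map_range ?_ ?_)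
  · intro k
    rw [M.coxeterGraph_adj_iff]
    by_cases hk : Even k <;> simp [hk, Nat.even_add_one, hij, hij.symm, h, hs]
  · intro k _
    by_cases hk : Even k <;> simp [hk, Nat.even_add_one, h, hs]

theorem succ_mod_eq_ite {n : ℕ} (hn : 0 < n) (k : ℕ) :
    (k + 1) % n = if k % n + 1 = n then 0 else k % n + 1 := by
  have hlt := Nat.mod_lt k hn
  rw [← Nat.mod_add_mod]
  split_ifs with h
  · rw [h, Nat.mod_self]
  · exact Nat.mod_eq_of_lt (by omega)

theorem isAcyclic_of_finite_isRigid (h : {ω : List B | IsRigid M ω}.Finite) :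
    M.coxeterGraph.IsAcyclic := by
  intro v p hp
  have hlen := hp.three_le_length
  have hmod := succ_mod_eq_ite (n := p.length) (by omega)
  have hlt := fun k => Nat.mod_lt k (y := p.length) (by omega)
  -- run around the cycle forever
  refine infinite_isRigid (q := fun k => p.getVert (k % p.length)) (isRigid_map_range ?_ ?_) h
  · intro k
    have := p.adj_getVert_succ (hlt k)
    rw [hmod]
    split_ifs with hk
    · rw [hk, SimpleGraph.Walk.getVert_length] at this
      rwa [p.getVert_zero]
    · exact this
  · intro k hk
    exfalso
    have := hp.getVert_injOn' (by rw [Set.mem_ofPred_eq]; have := hlt k; omega)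
      (by rw [Set.mem_ofPred_eq]; have := hlt (k + 2); omega) hk
    have h1 := hmod k
    have h2 := hmod (k + 1)
    rw [add_assoc] at h2
    generalize k % p.length = a at *
    generalize (k + 1) % p.length = b at *
    generalize (k + (1 + 1)) % p.length = c at *
    split_ifs at h1 h2 <;> omega

/-- A walk `P 0, …, P N` without turns whose first and last edges have labels greater than three can
be run back and forth forever. -/
theorem infinite_isRigid_of_bounce {P : ℕ → B} {N : ℕ} (hN : 2 ≤ N)
    (hadj : ∀ k < N, M.coxeterGraph.Adj (P k) (P (k + 1)))
    (hne : ∀ k, k + 2 ≤ N → P k ≠ P (k + 2))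
    (hfirst : M (P 0) (P 1) ≠ 3) (hlast : M (P (N - 1)) (P N) ≠ 3) :
    {ω : List B | IsRigid M ω}.Infinite := by
  have hmod := succ_mod_eq_ite (n := 2 * N) (by omega)
  have hlt := fun k => Nat.mod_lt k (y := 2 * N) (by omega)
  -- `r k` is the position at time `k` of a point bouncing between `0` and `N`
  obtain ⟨r, hr⟩ : ∃ r : ℕ → ℕ, ∀ k, r k ≤ N ∧
      (r (k + 1) = r k + 1 ∨ r k = r (k + 1) + 1) ∧
      (r k = r (k + 2) → r k = 1 ∧ r (k + 1) = 0 ∨ r k + 1 = N ∧ r (k + 1) = N) := by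
    refine ⟨fun k => if k % (2 * N) ≤ N then k % (2 * N) else 2 * N - k % (2 * N), fun k => ?_⟩
    dsimp only
    have h0 := hlt k
    have h1 := hmod k
    have h2 := hmod (k + 1)
    rw [add_assoc] at h2
    generalize k % (2 * N) = a at *
    generalize (k + 1) % (2 * N) = b at *
    generalize (k + (1 + 1)) % (2 * N) = c at *
    refine ⟨?_, ?_, ?_⟩ <;> split_ifs at * <;> omega
  refine infinite_isRigid (q := fun k => P (r k)) (isRigid_map_range ?_ ?_)
  · intro k
    obtain ⟨h1, h2, -⟩ := hr k
    have h3 := (hr (k + 1)).1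
    rcases h2 with h2 | h2
    · rw [h2]
      exact hadj _ (by omega)
    · rw [h2]
      exact (hadj _ (by omega)).symm
  · intro k hk
    have hback : ∀ k, P (r k) = P (r (k + 2)) → r k = r (k + 2) := by
      intro k hk
      by_contra hcon
      obtain ⟨h1, h2, -⟩ := hr k
      obtain ⟨h3, h4, -⟩ := hr (k + 1)
      have h5 := (hr (k + 2)).1
      rw [add_assoc] at h4
      have : r (k + 2) = r k + 2 ∨ r k = r (k + 2) + 2 := by
        simp only [Nat.reduceAdd] at h4
        omega
      rcases this with h | h
      · exact hne (r k) (by omega) (h ▸ hk)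
      · exact hne (r (k + 2)) (by omega) (h ▸ hk.symm)
    have h1 := (hr k).2.2 (hback k hk)
    constructor
    · rcases h1 with ⟨h1, h2⟩ | ⟨h1, h2⟩
      · rw [h1, h2, M.symmetric]
        exact hfirst
      · rw [h2, show r k = N - 1 by omega]
        exact hlast
    · intro hk'
      exfalso
      have h2 := (hr (k + 1)).2.2 (hback (k + 1) hk')
      omega

/-- Two edges with labels greater than three in the same component give infinitely many rigid words:
a shortest walk joining them, extended by the two edges, has no turns. -/
theorem infinite_isRigid_of_ne {i j k l : B} (hij : M.coxeterGraph.Adj i j)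
    (hkl : M.coxeterGraph.Adj k l) (hik : M.coxeterGraph.Reachable i k)
    (hM : M i j ≠ 3) (hM' : M k l ≠ 3) (hne : s(i, j) ≠ s(k, l)) :
    {ω : List B | IsRigid M ω}.Infinite := by
  classical
  have hex : ∃ n u u' v v', s(u', u) = s(i, j) ∧ s(v, v') = s(k, l) ∧
      ∃ p : M.coxeterGraph.Walk u v, p.length = n :=
    ⟨_, i, j, k, l, Sym2.eq_swap, rfl, hik.some, rfl⟩
  obtain ⟨u, u', v, v', hu, hv, p, hp⟩ := Nat.find_spec hex
  have hmin : ∀ a a' b b', s(a', a) = s(i, j) → s(b, b') = s(k, l) →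
      ∀ p' : M.coxeterGraph.Walk a b, p.length ≤ p'.length := by
    intro a a' b b' ha hb p'
    rw [hp]
    exact Nat.find_min' hex ⟨a, a', b, b', ha, hb, p', rfl⟩
  have hedge : ∀ {a b c d : B}, s(a, b) = s(c, d) → M.coxeterGraph.Adj c d → M c d ≠ 3 →
      M.coxeterGraph.Adj a b ∧ M a b ≠ 3 := by
    intro a b c d h hadj h3
    rcases Sym2.eq_iff.mp h with ⟨rfl, rfl⟩ | ⟨rfl, rfl⟩
    · exact ⟨hadj, h3⟩
    · exact ⟨hadj.symm, by rwa [M.symmetric]⟩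
  obtain ⟨huadj, hu3⟩ := hedge hu hij hM
  obtain ⟨hvadj, hv3⟩ := hedge hv hkl hM'
  have hpath : p.IsPath := by
    obtain ⟨p', hp'⟩ := p.reachable.exists_walk_length_eq_dist
    exact p.isPath_of_length_eq_dist
      (le_antisymm (hp' ▸ hmin u u' v v' hu hv p') (SimpleGraph.dist_le p))
  -- the walk `u', u, …, v, v'`
  let P : ℕ → B := fun n => if n = 0 then u' else if n ≤ p.length + 1 then p.getVert (n - 1) else v'
  have hP0 : P 0 = u' := rfl
  have hPmid : ∀ n ≤ p.length, P (n + 1) = p.getVert n := fun n hn => by simp [P, hn]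
  have hPlast : P (p.length + 2) = v' := by simp [P]
  refine infinite_isRigid_of_bounce (P := P) (N := p.length + 2) (by omega) ?_ ?_ ?_ ?_
  · intro n hn
    rcases Nat.eq_zero_or_pos n with rfl | hn0
    · rw [hPmid 0 (by omega), hP0, p.getVert_zero]
      exact huadj
    obtain ⟨n, rfl⟩ := Nat.exists_eq_succ_of_ne_zero hn0.ne'
    rw [Nat.succ_eq_add_one, hPmid n (by omega)]
    rcases (show n ≤ p.length by omega).eq_or_lt with rfl | hlt
    · rw [hPlast, p.getVert_length]
      exact hvadj
    · rw [hPmid (n + 1) (by omega)]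
      exact p.adj_getVert_succ hlt
  · intro n hn heq
    rcases Nat.eq_zero_or_pos n with rfl | hn0
    · rw [hP0] at heq
      rcases Nat.eq_zero_or_pos p.length with h0 | h0
      · rw [h0] at hPlast
        rw [hPlast] at heq
        obtain rfl : u = v := SimpleGraph.Walk.eq_of_length_eq_zero h0
        rw [← hu, ← hv, heq, Sym2.eq_swap] at hne
        exact hne rfl
      · rw [hPmid 1 (by omega)] at heq
        have := hmin _ u v v' (by rw [← hu, heq, Sym2.eq_swap]) hv (p.drop 1)
        simp at this
        omega
    obtain ⟨n, rfl⟩ := Nat.exists_eq_succ_of_ne_zero hn0.ne'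
    rw [Nat.succ_eq_add_one, hPmid n (by omega)] at heq
    rcases (show n + 1 ≤ p.length by omega).eq_or_lt with hlast | hlt
    · rw [show n + 1 + 2 = p.length + 2 by omega, hPlast] at heq
      have := hmin u u' _ v hu (by rw [← hv, heq, Sym2.eq_swap]) (p.take n)
      simp at this
      omega
    · rw [hPmid (n + 2) (by omega)] at heq
      have := hpath.getVert_injOn (by rw [Set.mem_ofPred_eq]; omega)
        (by rw [Set.mem_ofPred_eq]; omega) heq
      omega
  · rw [hP0, hPmid 0 (by omega), p.getVert_zero]
    exact hu3
  · rw [hPlast, show p.length + 2 - 1 = p.length + 1 by omega, hPmid _ le_rfl, p.getVert_length]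
    exact hv3

theorem finite_of_finite_isRigid (h : {ω : List B | IsRigid M ω}.Finite) : Finite B := by
  by_contra hB
  rw [not_finite_iff_infinite] at hB
  refine Set.infinite_of_injective_forall_mem (f := fun i : B => [i])
    (fun i j hij => by simpa using hij) (fun i => ?_) h
  constructor
  · intro j hj
    simpa using hj.length_le
  · intro j k hjk hM hinf
    have hle := hinf.length_le
    rw [length_alternatingWord, List.length_singleton] at hle
    have := M.off_diagonal j k hjk
    omega

/-! ### Finiteness of the set of rigid words -/

/-- If the Coxeter graph is a finite forest with finite labels and at most one label greater than
three in each component, then the length of rigid words is bounded. -/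
theorem IsRigid.length_le [Fintype B] (hacyc : M.coxeterGraph.IsAcyclic) (h0 : ∀ i j, M i j ≠ 0)
    (hheavy : ∀ i j k l, M.coxeterGraph.Adj i j → M.coxeterGraph.Adj k l →
      M.coxeterGraph.Reachable i k → M i j ≠ 3 → M k l ≠ 3 → s(i, j) = s(k, l))
    {m : ℕ} (hm : ∀ i j, M i j ≤ m) {ω : List B} (hω : IsRigid M ω) :
    ω.length ≤ 2 * Fintype.card B + m + 1 := by
  by_contra! hlong
  set N := Fintype.card B
  obtain ⟨q, hq⟩ : ∃ q : ℕ → B, ∀ k < ω.length, ω[k]? = some (q k) := by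
    have hpos : 0 < ω.length := by omega
    exact ⟨fun k => ω.getD k ω[0], fun k hk => by simp [hk]⟩
  have hadj : ∀ {k}, k + 1 < ω.length → M.coxeterGraph.Adj (q k) (q (k + 1)) := hω.adj hq
  have hreach : ∀ a b, a ≤ b → b < ω.length → M.coxeterGraph.Reachable (q a) (q b) := by
    intro a b hab
    induction b, hab using Nat.le_induction with
    | base => exact fun _ => SimpleGraph.Reachable.refl _
    | succ b _ ih => exact fun hb => (ih (by omega)).trans (hadj hb).reachable
  -- any `N + 1` consecutive letters contain a turn
  have hexists : ∀ a, a + N < ω.length → ∃ k, a ≤ k ∧ k + 2 ≤ a + N ∧ q k = q (k + 2) := by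
    intro a ha
    by_contra! hcon
    have hinj := hacyc.injOn_of_ne (q := q) (a := a) (b := a + N)
      (fun k _ hk => hadj (by omega)) hcon
    have := Finset.card_le_card_of_injOn (s := Finset.Icc a (a + N)) (t := Finset.univ) q
      (by simp) (by simpa using hinj)
    simp [N] at this
    omega
  -- the turns form an interval
  have hconvex : ∀ d a, a + d + 2 < ω.length → q a = q (a + 2) → q (a + d) = q (a + d + 2) →
      ∀ k, a ≤ k → k ≤ a + d → q k = q (k + 2) := by
    intro d
    induction d using Nat.strong_induction_on with
    | _ d ih =>
      intro a hlen ha hd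
      by_cases hmid : ∃ e, 0 < e ∧ e < d ∧ q (a + e) = q (a + e + 2)
      · obtain ⟨e, he0, hed, he⟩ := hmid
        intro k hak hkd
        rcases le_total k (a + e) with hke | hke
        · exact ih e hed a (by omega) ha he k hak hke
        · have hsum : a + e + (d - e) = a + d := by omega
          exact ih (d - e) (by omega) (a + e) (by omega) he (by rwa [hsum]) k hke (by omega)
      · push Not at hmid
        rcases Nat.lt_or_ge d 2 with hd2 | hd2
        · intro k hak hkd
          rcases (show k = a ∨ k = a + d by omega) with rfl | rfl
          · exact ha
          · exact hd
        exfalso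
        -- no turn strictly between: the letters from `a + 1` to `a + d + 1` are distinct, but the
        -- edges at which the two turns take place are equal
        have hinj := hacyc.injOn_of_ne (q := q) (a := a + 1) (b := a + d + 1)
          (fun k _ hk => hadj (by omega)) (fun k hk hk' => by
            have := hmid (k - a) (by omega) (by omega)
            rwa [show a + (k - a) = k by omega] at this)
        have heq := hheavy _ _ _ _ (hadj (by omega)) (hadj (by omega))
          (hreach a (a + d) (by omega) (by omega)) (hω.ne_three hq (by omega) ha)
          (hω.ne_three hq (by omega) hd)
        rcases Sym2.eq_iff.mp heq with ⟨-, h⟩ | ⟨-, h⟩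
        · have := hinj (Set.mem_Icc.mpr ⟨by omega, by omega⟩)
            (Set.mem_Icc.mpr ⟨by omega, by omega⟩) h
          omega
        · have := hinj (Set.mem_Icc.mpr ⟨by omega, by omega⟩)
            (Set.mem_Icc.mpr ⟨by omega, by omega⟩) h
          omega
  -- all letters between a turn near the start and one near the end are turns, so that the word
  -- alternates for at least `m` letters
  obtain ⟨a, -, haN, ha⟩ := hexists 0 (by omega)
  obtain ⟨b, hb, hbN, hb'⟩ := hexists (N + m) (by omega)
  obtain ⟨t, ht, htne⟩ := hω.exists_ne_add_two hq (p := a) (hadj (by omega)).ne (h0 _ _)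
    (by have := hm (q a) (q (a + 1)); omega)
  have := hm (q a) (q (a + 1))
  exact htne (hconvex (b - a) a (by omega) ha (by rwa [show a + (b - a) = b by omega]) (a + t)
    (by omega) (by omega))

theorem finite_isRigid_iff :
    {ω : List B | IsRigid M ω}.Finite ↔ Finite B ∧ M.coxeterGraph.IsAcyclic ∧ (∀ i j, M i j ≠ 0) ∧
      ∀ i j k l, M.coxeterGraph.Adj i j → M.coxeterGraph.Adj k l →
        M.coxeterGraph.Reachable i k → M i j ≠ 3 → M k l ≠ 3 → s(i, j) = s(k, l) := by
  constructor
  · intro h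
    refine ⟨finite_of_finite_isRigid h, isAcyclic_of_finite_isRigid h,
      fun i j hij => infinite_isRigid_of_eq_zero hij h, fun i j k l hij hkl hik hM hM' => ?_⟩
    by_contra hne
    exact infinite_isRigid_of_ne hij hkl hik hM hM' hne h
  · rintro ⟨hfin, hacyc, h0, hheavy⟩
    have := Fintype.ofFinite B
    obtain ⟨m, hm⟩ : ∃ m, ∀ i j, M i j ≤ m := by
      obtain ⟨m, hm⟩ := (Set.finite_range fun p : B × B => M p.1 p.2).bddAbove
      exact ⟨m, fun i j => hm ⟨(i, j), rfl⟩⟩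
    exact (List.finite_length_le B _).subset fun ω hω => hω.length_le hacyc h0 hheavy hm

end CoxeterSystem

theorem mainTheorem3 {B : Type*} {W : Type*} [Group W] (M : CoxeterMatrix B)
    (cs : CoxeterSystem M W) :
    {w : W | cs.HasUniqueReducedExpression w}.Finite ↔
      Finite B ∧ ∀ C : M.coxeterGraph.ConnectedComponent,
        C.toSimpleGraph.IsTree ∧
        (∀ e ∈ M.componentEdges C, M.edgeLabel e ≠ ⊤) ∧
        {e ∈ M.componentEdges C | 3 < M.edgeLabel e}.encard ≤ 1 := by
  rw [cs.finite_hasUniqueReducedExpression_iff, CoxeterSystem.finite_isRigid_iff,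
    M.forall_connectedComponent_iff]
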